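/- Let $\operatorname{Bess}$ be the Bessel operad: the symmetric operad in graded $\mathbb{Q}$-vector spaces (with Koszul signs), defined on finite sets of labels, generated by a symmetric element $E_{i,j}$ of degree $0$ and an antisymmetric element $\Omega_{i,j}$ of degree $1$ in $\operatorname{Bess}(\{i,j\})$, with the relations $$E_{i,\star}\circ_\star E_{j,k}=E_{k,\star}\circ_\star E_{i,j},\qquad \Omega_{i,\star}\circ_\star E_{j,k}=E_{j,\star}\circ_\star\Omega_{i,k}+E_{k,\star}\circ_\star\Omega_{i,j}.$$ For a finite set $I$, $\operatorname{Bess}(I)$ has a basis indexed by the forests of rooted binary trees with leaves labelled bijectively by $I$ (each forest taken with a chosen orientation); here $E$ acts by disjoint union, $\Omega$ joins two trees at a new inner vertex, and the degree is the number of inner vertices. Let $\Delta:\operatorname{Bess}\to\operatorname{Bess}\otimes\operatorname{Bess}$ be the morphism of operads with $$\Delta(E_{i,j})=E_{i,j}\otimes E_{i,j},\qquad \Delta(\Omega_{i,j})=E_{i,j}\otimes\Omega_{i,j}+\Omega_{i,j}\otimes E_{i,j}.$$ Let $\operatorname{Bess}^*(I)$ be the dual space of $\operatorname{Bess}(I)$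 with the product $(f\times g)(x)=\sum f(x')\,g(x'')$ for $\Delta(x)=\sum x'\otimes x''$ (no Koszul sign; this is the opposite of the graded dual product). For $i\neq j$ in $I$, let $Y_{i,j}\in\operatorname{Bess}^*(I)$ be the element of the dual basis that corresponds to the forest on $I$ with exactly one inner vertex, whose only nontrivial tree has the leaves $i,j$, oriented as $\Omega_{i,j}$. Then, for any three distinct elements $i,j,k$ of a finite set $I$, $$Y_{i,j}\times Y_{j,k}\times Y_{k,i}=0\quad\text{in }\operatorname{Bess}^*(I),$$ for either way of placing the parentheses. -/

import Mathlib

open scoped TensorProduct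

namespace Bessel

noncomputable section

/-- Binary composites of the two generators `E` and `Ω` of the Bessel operad, with inputs labelled
by `I`.  `E a b` is the operadic composite `(E_{⋆,#} ∘_⋆ a) ∘_# b`, and `Ω a b` is
`(Ω_{⋆,#} ∘_⋆ a) ∘_# b`.  A term without `E` is a rooted binary tree, whose inner vertices are the
nodes `Ω`; `E` is disjoint union. -/
inductive Term (I : Type*) : Type _
  | leaf (i : I) : Term I
  | E (a b : Term I) : Term I
  | Ω (a b : Term I) : Term I

namespace Term

variable {I : Type*}

/-- The multiset of labels of the leaves. -/
def leaves : Term I → Multiset I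
  | leaf i => {i}
  | E a b => a.leaves + b.leaves
  | Ω a b => a.leaves + b.leaves

/-- The degree: `E` has degree `0` and `Ω` has degree `1`. -/
def deg : Term I → ℕ
  | leaf _ => 0
  | E a b => a.deg + b.deg
  | Ω a b => a.deg + b.deg + 1

/-- Terms without `E`: rooted binary trees, with a planar order of the inputs of each inner vertex
that records the orientation. -/
def IsTree : Term I → Prop
  | leaf _ => True
  | E _ _ => False
  | Ω a b => a.IsTree ∧ b.IsTree

/-- Oriented forests: disjoint unions of trees. -/
def IsForest : Term I → Prop
  | leaf _ => True
  | E a b => a.IsForest ∧ b.IsForest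
  | Ω a b => a.IsTree ∧ b.IsTree

/-- The trees of a forest. -/
def trees : Term I → Multiset (Term I)
  | E a b => a.trees + b.trees
  | leaf i => {leaf i}
  | Ω a b => {Ω a b}

end Term

open Term

/-- The Koszul sign `(-1)^n`. -/
def sgn (n : ℕ) : ℚ := (-1) ^ n

section Space

variable {I : Type*}

/-- The relations of the Bessel operad, evaluated at arbitrary terms (in the order of the
variables `a`, `b`, `c`, hence the Koszul signs) and inserted at an arbitrary place:
`E` is symmetric of degree `0`, `Ω` is antisymmetric of degree `1`,
`E_{i,⋆} ∘_⋆ E_{j,k} = E_{k,⋆} ∘_⋆ E_{i,j}` and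
`Ω_{i,⋆} ∘_⋆ E_{j,k} = E_{j,⋆} ∘_⋆ Ω_{i,k} + E_{k,⋆} ∘_⋆ Ω_{i,j}`. -/
inductive Rel : (Term I →₀ ℚ) → Prop
  | symm (a b : Term I) :
      Rel (.single (E a b) 1 - .single (E b a) (sgn (a.deg * b.deg)))
  | antisymm (a b : Term I) :
      Rel (.single (Ω a b) 1 + .single (Ω b a) (sgn (a.deg * b.deg)))
  | assoc (a b c : Term I) :
      Rel (.single (E a (E b c)) 1 - .single (E (E a b) c) 1)
  | leibniz (a b c : Term I) :
      Rel (.single (Ω a (E b c)) 1 - .single (E (Ω a b) c) 1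
        - .single (E b (Ω a c)) (sgn (b.deg * (a.deg + 1))))
  | E_left (r : Term I →₀ ℚ) (t : Term I) : Rel r → Rel (r.mapDomain fun x => E x t)
  | E_right (t : Term I) (r : Term I →₀ ℚ) : Rel r → Rel (r.mapDomain fun x => E t x)
  | Ω_left (r : Term I →₀ ℚ) (t : Term I) : Rel r → Rel (r.mapDomain fun x => Ω x t)
  | Ω_right (t : Term I) (r : Term I →₀ ℚ) : Rel r → Rel (r.mapDomain fun x => Ω t x)

variable (I) [Fintype I]

/-- Terms in which each element of `I` labels exactly one leaf. -/
abbrev LinTerm : Type _ := {t : Term I // t.leaves = Finset.univ.val}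

/-- The relations between such terms. -/
def relations : Submodule ℚ (LinTerm I →₀ ℚ) :=
  Submodule.span ℚ {r | Rel (r.mapDomain Subtype.val)}

/-- The component `Bess(I)` of the Bessel operad, presented by generators and relations. -/
abbrev Bess : Type _ := (LinTerm I →₀ ℚ) ⧸ relations I

variable {I}

/-- The element of `Bess(I)` given by a multilinear term. -/
def mk (t : LinTerm I) : Bess I := (relations I).mkQ (.single t 1)

variable [DecidableEq I]

/-- The class of a term in `Bess(I)`, extended by `0` to the terms that are not multilinear. -/
def cls (t : Term I) : Bess I := if h : t.leaves = Finset.univ.val then mk ⟨t, h⟩ else 0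

end Space

section Coproduct

variable {I : Type*}

/-- The expansion of the coproduct of a term as a list of triples `(c, t', t'')`, which stands for
the sum of the `c • t' ⊗ t''`.  It is the operad morphism with `Δ(E) = E ⊗ E` and
`Δ(Ω) = E ⊗ Ω + Ω ⊗ E`, with the Koszul signs of the composition in the tensor product of two
operads, `(p ⊗ q) ∘ (p' ⊗ q') = (-1)^{|q||p'|} (p ∘ p') ⊗ (q ∘ q')`. -/
def expand : Term I → List (ℚ × Term I × Term I)
  | leaf i => [(1, leaf i, leaf i)]
  | E a b => (expand a).flatMap fun p => (expand b).map fun q =>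
      (p.1 * q.1 * sgn (p.2.2.deg * q.2.1.deg), E p.2.1 q.2.1, E p.2.2 q.2.2)
  | Ω a b =>
      ((expand a).flatMap fun p => (expand b).map fun q =>
        (p.1 * q.1 * sgn (p.2.2.deg * q.2.1.deg), Ω p.2.1 q.2.1, E p.2.2 q.2.2)) ++
      ((expand a).flatMap fun p => (expand b).map fun q =>
        (p.1 * q.1 * sgn (p.2.1.deg + (1 + p.2.2.deg) * q.2.1.deg),
          E p.2.1 q.2.1, Ω p.2.2 q.2.2))

/-- The value of such an expansion when terms are evaluated by `F` in a vector space. -/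
def evalExp {M : Type*} [AddCommGroup M] [Module ℚ M] (F : Term I → M)
    (l : List (ℚ × Term I × Term I)) : M ⊗[ℚ] M :=
  (l.map fun p => p.1 • (F p.2.1 ⊗ₜ[ℚ] F p.2.2)).sum

/-! The expansion is compatible with the relations. -/

theorem sgn_eq {m n : ℕ} (h : (m : ZMod 2) = n) : sgn m = sgn n := by
  have h' : m % 2 = n % 2 := (ZMod.natCast_eq_natCast_iff' m n 2).1 h
  unfold sgn
  rw [← Nat.div_add_mod m 2, ← Nat.div_add_mod n 2, h']
  simp [pow_add, pow_mul]

theorem sgn_mul (m n : ℕ) : sgn m * sgn n = sgn (m + n) := (pow_add _ _ _).symm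

theorem Rel.homogeneous {r : Term I →₀ ℚ} (h : Rel r) :
    ∃ (m : Multiset I) (d : ℕ), ∀ t ∈ r.support, t.leaves = m ∧ t.deg = d := by
  classical
  have key (r : Term I →₀ ℚ) (f : Term I → Term I) (g : Multiset I → Multiset I) (e : ℕ → ℕ)
      (hf : ∀ t, (f t).leaves = g t.leaves ∧ (f t).deg = e t.deg)
      (ih : ∃ (m : Multiset I) (d : ℕ), ∀ t ∈ r.support, t.leaves = m ∧ t.deg = d) :
      ∃ (m : Multiset I) (d : ℕ), ∀ t ∈ (r.mapDomain f).support, t.leaves = m ∧ t.deg = d := by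
    obtain ⟨m, d, H⟩ := ih
    refine ⟨g m, e d, fun t ht => ?_⟩
    obtain ⟨x, hx, rfl⟩ := Finset.mem_image.1 (Finsupp.mapDomain_support ht)
    rw [(hf x).1, (hf x).2, (H x hx).1, (H x hx).2]
    exact ⟨rfl, rfl⟩
  have sup (t s : Term I) (c : ℚ) (h : (Finsupp.single t c) s ≠ 0) : s = t := by
    by_contra hne
    exact h (Finsupp.single_eq_of_ne hne)
  induction h with
  | symm a b =>
    refine ⟨a.leaves + b.leaves, a.deg + b.deg, fun t ht => ?_⟩
    rcases Finset.mem_union.1 (Finsupp.support_sub ht) with h | h <;>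
      obtain rfl := sup _ _ _ (Finsupp.mem_support_iff.1 h) <;> simp [leaves, deg, add_comm]
  | antisymm a b =>
    refine ⟨a.leaves + b.leaves, a.deg + b.deg + 1, fun t ht => ?_⟩
    rcases Finset.mem_union.1 (Finsupp.support_add ht) with h | h <;>
      obtain rfl := sup _ _ _ (Finsupp.mem_support_iff.1 h) <;> simp [leaves, deg, add_comm]
  | assoc a b c =>
    refine ⟨a.leaves + b.leaves + c.leaves, a.deg + b.deg + c.deg, fun t ht => ?_⟩
    rcases Finset.mem_union.1 (Finsupp.support_sub ht) with h | h <;>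
      obtain rfl := sup _ _ _ (Finsupp.mem_support_iff.1 h) <;> simp [leaves, deg, add_assoc]
  | leibniz a b c =>
    refine ⟨a.leaves + b.leaves + c.leaves, a.deg + b.deg + c.deg + 1, fun t ht => ?_⟩
    rcases Finset.mem_union.1 (Finsupp.support_sub ht) with h | h
    · rcases Finset.mem_union.1 (Finsupp.support_sub h) with h | h <;>
        obtain rfl := sup _ _ _ (Finsupp.mem_support_iff.1 h) <;>
        simp only [leaves, deg, add_assoc, true_and] <;> omega
    · obtain rfl := sup _ _ _ (Finsupp.mem_support_iff.1 h)
      simp only [leaves, deg]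
      exact ⟨by abel, by omega⟩
  | E_left r t _ ih => exact key r _ (· + t.leaves) (· + t.deg) (fun _ => ⟨rfl, rfl⟩) ih
  | E_right t r _ ih => exact key r _ (t.leaves + ·) (t.deg + ·) (fun _ => ⟨rfl, rfl⟩) ih
  | Ω_left r t _ ih => exact key r _ (· + t.leaves) (· + t.deg + 1) (fun _ => ⟨rfl, rfl⟩) ih
  | Ω_right t r _ ih => exact key r _ (t.leaves + ·) (t.deg + · + 1) (fun _ => ⟨rfl, rfl⟩) ih

variable (I) in
/-- The span of the relations between all terms. -/
def allRelations : Submodule ℚ (Term I →₀ ℚ) := Submodule.span ℚ {r | Rel r}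

variable (I) in
/-- All terms modulo all relations. -/
abbrev Alg : Type _ := (Term I →₀ ℚ) ⧸ allRelations I

/-- The class of a term in `Alg I`. -/
def cA (t : Term I) : Alg I := (allRelations I).mkQ (.single t 1)

theorem linearCombination_cA (r : Term I →₀ ℚ) :
    Finsupp.linearCombination ℚ (cA (I := I)) r = (allRelations I).mkQ r := by
  have : Finsupp.linearCombination ℚ (cA (I := I)) = (allRelations I).mkQ := by
    ext t; simp [cA]
  rw [this]

theorem linearCombination_cA_of_rel {r : Term I →₀ ℚ} (h : Rel r) :
    Finsupp.linearCombination ℚ (cA (I := I)) r = 0 := by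
  rw [linearCombination_cA, Submodule.mkQ_apply, Submodule.Quotient.mk_eq_zero]
  exact Submodule.subset_span h

/-- A function on terms, extended linearly, descends to `Alg I` if it respects the relations. -/
def descend {M : Type*} [AddCommGroup M] [Module ℚ M] (F : Term I → M)
    (hF : ∀ r, Rel r → Finsupp.linearCombination ℚ F r = 0) : Alg I →ₗ[ℚ] M :=
  (allRelations I).liftQ (Finsupp.linearCombination ℚ F)
    (Submodule.span_le.2 fun r hr => hF r hr)

@[simp] theorem descend_cA {M : Type*} [AddCommGroup M] [Module ℚ M] (F : Term I → M)
    (hF : ∀ r, Rel r → Finsupp.linearCombination ℚ F r = 0) (t : Term I) :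
    descend F hF (cA t) = F t := by
  have := LinearMap.congr_fun ((allRelations I).liftQ_mkQ (Finsupp.linearCombination ℚ F)
    (Submodule.span_le.2 fun r hr => hF r hr)) (.single t 1)
  rw [LinearMap.comp_apply, Finsupp.linearCombination_single, one_smul] at this
  exact this

theorem linearCombination_context (f : Term I → Term I) (r : Term I →₀ ℚ)
    (h : Rel (r.mapDomain f)) : Finsupp.linearCombination ℚ (fun t => cA (f t)) r = 0 := by
  rw [← linearCombination_cA_of_rel h, Finsupp.linearCombination_mapDomain]; rfl

/-- Multiplication of a term by a sign that depends on its degree. -/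
def signA (n : ℕ) : Alg I →ₗ[ℚ] Alg I :=
  descend (fun t => sgn (n * t.deg) • cA t) fun r hr => by
    obtain ⟨m, d, H⟩ := hr.homogeneous
    have : Finsupp.linearCombination ℚ (fun t : Term I => sgn (n * t.deg) • cA t) r =
        sgn (n * d) • Finsupp.linearCombination ℚ (cA (I := I)) r := by
      simp only [Finsupp.linearCombination_apply, Finsupp.sum, Finset.smul_sum]
      refine Finset.sum_congr rfl fun t ht => ?_
      rw [(H t ht).2, smul_comm]
    rw [this, linearCombination_cA_of_rel hr, smul_zero]

def ElA (t : Term I) : Alg I →ₗ[ℚ] Alg I :=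
  descend (fun x => cA (E x t)) fun r hr => linearCombination_context _ r (hr.E_left r t)
def ErA (t : Term I) : Alg I →ₗ[ℚ] Alg I :=
  descend (fun x => cA (E t x)) fun r hr => linearCombination_context _ r (hr.E_right t r)
def ΩlA (t : Term I) : Alg I →ₗ[ℚ] Alg I :=
  descend (fun x => cA (Ω x t)) fun r hr => linearCombination_context _ r (hr.Ω_left r t)
def ΩrA (t : Term I) : Alg I →ₗ[ℚ] Alg I :=
  descend (fun x => cA (Ω t x)) fun r hr => linearCombination_context _ r (hr.Ω_right t r)

theorem cA_symm (a b : Term I) : cA (E b a) = sgn (a.deg * b.deg) • cA (E a b) := by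
  have := linearCombination_cA_of_rel (Rel.symm b a)
  simp only [map_sub, Finsupp.linearCombination_single, one_smul, sub_eq_zero] at this
  rw [this, mul_comm]

theorem cA_antisymm (a b : Term I) : cA (Ω b a) = -(sgn (a.deg * b.deg) • cA (Ω a b)) := by
  have := linearCombination_cA_of_rel (Rel.antisymm b a)
  simp only [map_add, Finsupp.linearCombination_single, one_smul] at this
  rw [eq_neg_of_add_eq_zero_left this, mul_comm]

theorem cA_assoc (a b c : Term I) : cA (E a (E b c)) = cA (E (E a b) c) := by
  have := linearCombination_cA_of_rel (Rel.assoc a b c)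
  simpa only [map_sub, Finsupp.linearCombination_single, one_smul, sub_eq_zero] using this

theorem cA_leibniz (a b c : Term I) :
    cA (Ω a (E b c)) = cA (E (Ω a b) c) + sgn (b.deg * (a.deg + 1)) • cA (E b (Ω a c)) := by
  have := linearCombination_cA_of_rel (Rel.leibniz a b c)
  simp only [map_sub, Finsupp.linearCombination_single, one_smul] at this
  rw [sub_sub, sub_eq_zero] at this
  exact this

theorem cA_left_comm (a b c : Term I) :
    cA (E b (E a c)) = sgn (a.deg * b.deg) • cA (E a (E b c)) := by
  have h := congrArg (ElA c) (cA_symm a b)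
  simp only [map_smul, ElA, descend_cA] at h
  rw [cA_assoc, h, cA_assoc]

theorem deg_expand (t : Term I) : ∀ p ∈ expand t, p.2.1.deg + p.2.2.deg = t.deg := by
  induction t with
  | leaf i => simp [expand, deg]
  | E a b iha ihb =>
    intro p hp
    simp only [expand, List.mem_flatMap, List.mem_map] at hp
    obtain ⟨x, hx, y, hy, rfl⟩ := hp
    have := iha x hx
    have := ihb y hy
    simp only [deg]; omega
  | Ω a b iha ihb =>
    intro p hp
    simp only [expand, List.mem_append, List.mem_flatMap, List.mem_map] at hp
    rcases hp with ⟨x, hx, y, hy, rfl⟩ | ⟨x, hx, y, hy, rfl⟩ <;>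
    · have := iha x hx
      have := ihb y hy
      simp only [deg]; omega

section ListSum

variable {α β γ M : Type*} [AddCommGroup M]

/-- The sum of `f` over a list. -/
def lsum (l : List α) (f : α → M) : M := (l.map f).sum

theorem lsum_flatMap (l : List α) (m : List β) (g : α → β → γ) (f : γ → M) :
    lsum (l.flatMap fun p => m.map (g p)) f = lsum l fun p => lsum m fun q => f (g p q) := by
  induction l with
  | nil => rfl
  | cons x l ih =>
    simp only [lsum] at ih ⊢
    rw [List.flatMap_cons, List.map_append, List.sum_append, ih, List.map_map]; rfl

theorem lsum_append (l m : List α) (f : α → M) : lsum (l ++ m) f = lsum l f + lsum m f := by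
  simp [lsum]

theorem lsum_add (l : List α) (f g : α → M) :
    lsum l (fun x => f x + g x) = lsum l f + lsum l g := by
  induction l with
  | nil => simp [lsum]
  | cons x l ih => simp only [lsum, List.map_cons, List.sum_cons] at ih ⊢; rw [ih]; abel

theorem lsum_comm (l : List α) (m : List β) (f : α → β → M) :
    (lsum l fun x => lsum m fun y => f x y) = lsum m fun y => lsum l fun x => f x y := by
  induction l with
  | nil => induction m <;> simp_all [lsum]
  | cons x l ih =>
    have h (y : β) : lsum (x :: l) (fun x => f x y) = f x y + lsum l (fun x => f x y) := by
      simp [lsum]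
    simp only [h, lsum_add, ← ih]
    simp [lsum]

theorem lsum_congr {l : List α} {f g : α → M} (h : ∀ x ∈ l, f x = g x) : lsum l f = lsum l g := by
  unfold lsum
  rw [List.map_congr_left h]

theorem smul_lsum [Module ℚ M] (c : ℚ) (l : List α) (f : α → M) :
    c • lsum l f = lsum l fun x => c • f x := by
  induction l with
  | nil => simp [lsum]
  | cons x l ih => simp only [lsum, List.map_cons, List.sum_cons, smul_add] at ih ⊢; rw [ih]

theorem lsum_apply {N P : Type*} [AddCommGroup N] [Module ℚ N] [AddCommGroup P] [Module ℚ P]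
    (l : List α) (f : α → N →ₗ[ℚ] P) (x : N) : lsum l f x = lsum l fun a => f a x := by
  induction l with
  | nil => simp [lsum]
  | cons y l ih =>
    simp only [lsum, List.map_cons, List.sum_cons, LinearMap.add_apply] at ih ⊢; rw [ih]

theorem map_lsum {N F : Type*} [AddCommGroup N] [FunLike F M N] [AddMonoidHomClass F M N] (φ : F)
    (l : List α) (f : α → M) : φ (lsum l f) = lsum l fun x => φ (f x) := by
  induction l with
  | nil => simp [lsum]
  | cons x l ih => simp only [lsum, List.map_cons, List.sum_cons, map_add] at ih ⊢; rw [ih]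

end ListSum

/-- The coproduct of a term with values in `Alg I ⊗ Alg I`. -/
def coA (t : Term I) : Alg I ⊗[ℚ] Alg I := evalExp cA (expand t)

/-- The summands of the coproduct of `E a b`. -/
def sE (p q : ℚ × Term I × Term I) : ℚ × Term I × Term I :=
  (p.1 * q.1 * sgn (p.2.2.deg * q.2.1.deg), E p.2.1 q.2.1, E p.2.2 q.2.2)
def sΩ₁ (p q : ℚ × Term I × Term I) : ℚ × Term I × Term I :=
  (p.1 * q.1 * sgn (p.2.2.deg * q.2.1.deg), Ω p.2.1 q.2.1, E p.2.2 q.2.2)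
def sΩ₂ (p q : ℚ × Term I × Term I) : ℚ × Term I × Term I :=
  (p.1 * q.1 * sgn (p.2.1.deg + (1 + p.2.2.deg) * q.2.1.deg), E p.2.1 q.2.1, Ω p.2.2 q.2.2)

theorem lsum_expand_E {M : Type*} [AddCommGroup M] (a b : Term I)
    (f : ℚ × Term I × Term I → M) :
    lsum (expand (E a b)) f = lsum (expand a) fun p => lsum (expand b) fun q => f (sE p q) :=
  lsum_flatMap _ _ _ _

theorem lsum_expand_Ω {M : Type*} [AddCommGroup M] (a b : Term I)
    (f : ℚ × Term I × Term I → M) :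
    lsum (expand (Ω a b)) f =
      lsum (expand a) fun p => lsum (expand b) fun q => f (sΩ₁ p q) + f (sΩ₂ p q) := by
  rw [expand, lsum_append, lsum_flatMap, lsum_flatMap, ← lsum_add]
  refine lsum_congr fun p _ => ?_
  rw [← lsum_add]; rfl

/-- The value of a summand. -/
def vA (p : ℚ × Term I × Term I) : Alg I ⊗[ℚ] Alg I := p.1 • (cA p.2.1 ⊗ₜ[ℚ] cA p.2.2)

theorem coA_eq (t : Term I) : coA t = lsum (expand t) vA := rfl

theorem coA_symm (a b : Term I) : coA (E a b) = sgn (a.deg * b.deg) • coA (E b a) := by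
  rw [coA_eq, coA_eq, lsum_expand_E, lsum_expand_E, lsum_comm (expand b), smul_lsum]
  refine lsum_congr fun p hp => ?_
  rw [smul_lsum]
  refine lsum_congr fun q hq => ?_
  rw [← deg_expand a p hp, ← deg_expand b q hq]
  obtain ⟨c, a', a''⟩ := p
  obtain ⟨d, b', b''⟩ := q
  simp only [vA, sE]
  rw [cA_symm a' b', cA_symm a'' b'']
  simp only [TensorProduct.tmul_smul, ← TensorProduct.smul_tmul', smul_smul]
  congr 1
  have : sgn (a''.deg * b'.deg) = sgn ((a'.deg + a''.deg) * (b'.deg + b''.deg) +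
      b''.deg * a'.deg + a''.deg * b''.deg + a'.deg * b'.deg) := by
    apply sgn_eq
    push_cast
    generalize (a'.deg : ZMod 2) = x1, (a''.deg : ZMod 2) = x2, (b'.deg : ZMod 2) = y1,
      (b''.deg : ZMod 2) = y2
    revert x1 x2 y1 y2; decide
  simp only [← sgn_mul] at this
  rw [this]; ring

theorem coA_antisymm (a b : Term I) : coA (Ω a b) = (-sgn (a.deg * b.deg)) • coA (Ω b a) := by
  rw [coA_eq, coA_eq, lsum_expand_Ω, lsum_expand_Ω, lsum_comm (expand b),
    smul_lsum]
  refine lsum_congr fun p hp => ?_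
  rw [smul_lsum]
  refine lsum_congr fun q hq => ?_
  rw [← deg_expand a p hp, ← deg_expand b q hq]
  obtain ⟨c, a', a''⟩ := p
  obtain ⟨d, b', b''⟩ := q
  simp only [vA, sΩ₁, sΩ₂]
  rw [cA_symm a' b', cA_symm a'' b'', cA_antisymm a' b', cA_antisymm a'' b'']
  simp only [TensorProduct.tmul_smul, ← TensorProduct.smul_tmul', smul_smul, smul_add,
    ← neg_smul]
  have h1 : sgn (a''.deg * b'.deg) = sgn ((a'.deg + a''.deg) * (b'.deg + b''.deg) +
      b''.deg * a'.deg + a''.deg * b''.deg + a'.deg * b'.deg) := by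
    apply sgn_eq
    push_cast
    generalize (a'.deg : ZMod 2) = x1, (a''.deg : ZMod 2) = x2, (b'.deg : ZMod 2) = y1,
      (b''.deg : ZMod 2) = y2
    revert x1 x2 y1 y2; decide
  have h2 : sgn (a'.deg + (1 + a''.deg) * b'.deg) =
      sgn ((a'.deg + a''.deg) * (b'.deg + b''.deg) +
      (b'.deg + (1 + b''.deg) * a'.deg) + a''.deg * b''.deg + a'.deg * b'.deg) := by
    apply sgn_eq
    push_cast
    generalize (a'.deg : ZMod 2) = x1, (a''.deg : ZMod 2) = x2, (b'.deg : ZMod 2) = y1,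
      (b''.deg : ZMod 2) = y2
    revert x1 x2 y1 y2; decide
  rw [h1, h2]
  simp only [← sgn_mul]
  match_scalars <;> ring

theorem coA_assoc (a b c : Term I) : coA (E a (E b c)) = coA (E (E a b) c) := by
  rw [coA_eq, coA_eq, lsum_expand_E, lsum_expand_E, lsum_expand_E]
  refine lsum_congr fun p hp => ?_
  rw [lsum_expand_E]
  refine lsum_congr fun q hq => lsum_congr fun r hr => ?_
  simp only [vA, sE, deg]
  rw [cA_assoc, cA_assoc]
  congr 1
  have h : sgn (q.2.2.deg * r.2.1.deg + p.2.2.deg * (q.2.1.deg + r.2.1.deg)) =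
      sgn (p.2.2.deg * q.2.1.deg + (p.2.2.deg + q.2.2.deg) * r.2.1.deg) := by
    congr 1; ring
  simp only [← sgn_mul] at h
  linear_combination p.1 * q.1 * r.1 * h

theorem coA_leibniz (a b c : Term I) : coA (Ω a (E b c)) =
    coA (E (Ω a b) c) + sgn (b.deg * (a.deg + 1)) • coA (E b (Ω a c)) := by
  simp only [coA_eq, lsum_expand_E, lsum_expand_Ω]
  rw [lsum_comm (expand b), smul_lsum, ← lsum_add]
  refine lsum_congr fun p hp => ?_
  rw [smul_lsum, ← lsum_add]
  refine lsum_congr fun q hq => ?_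
  rw [smul_lsum, ← lsum_add, ← lsum_add]
  refine lsum_congr fun r hr => ?_
  rw [← deg_expand a p hp, ← deg_expand b q hq]
  obtain ⟨c, a', a''⟩ := p
  obtain ⟨d, b', b''⟩ := q
  obtain ⟨e, c', c''⟩ := r
  simp only [vA, sE, sΩ₁, sΩ₂, deg]
  rw [cA_leibniz a' b' c', cA_leibniz a'' b'' c'', cA_left_comm a' b' c', cA_left_comm a'' b'' c'',
    cA_assoc a' b' c', cA_assoc a'' b'' c'']
  simp only [TensorProduct.tmul_add, TensorProduct.add_tmul, TensorProduct.tmul_smul,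
    ← TensorProduct.smul_tmul', smul_smul, smul_add]
  match_scalars
  · have h : sgn (b''.deg * c'.deg) * sgn (a''.deg * (b'.deg + c'.deg)) = sgn (a''.deg * b'.deg) *
        sgn ((a''.deg + b''.deg) * c'.deg) := by
      simp only [sgn_mul]
      apply sgn_eq
      push_cast
      generalize (a'.deg : ZMod 2) = x1, (a''.deg : ZMod 2) = x2, (b'.deg : ZMod 2) = y1,
        (b''.deg : ZMod 2) = y2, (c'.deg : ZMod 2) = z1
      revert x1 x2 y1 y2 z1; decide
    linear_combination c * d * e * h
  · have h : sgn (b''.deg * c'.deg) * sgn (a''.deg * (b'.deg + c'.deg)) *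
        sgn (b'.deg * (a'.deg + 1)) = sgn ((b'.deg + b''.deg) * (a'.deg + a''.deg + 1)) *
        sgn (a''.deg * c'.deg) * sgn (b''.deg * (a'.deg + c'.deg + 1)) * sgn (a''.deg * b''.deg) := by
      simp only [sgn_mul]
      apply sgn_eq
      push_cast
      generalize (a'.deg : ZMod 2) = x1, (a''.deg : ZMod 2) = x2, (b'.deg : ZMod 2) = y1,
        (b''.deg : ZMod 2) = y2, (c'.deg : ZMod 2) = z1
      revert x1 x2 y1 y2 z1; decide
    linear_combination c * d * e * h
  · have h : sgn (b''.deg * c'.deg) * sgn (a'.deg + (1 + a''.deg) * (b'.deg + c'.deg)) = 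
        sgn (a'.deg + (1 + a''.deg) * b'.deg) * sgn ((a''.deg + b''.deg + 1) * c'.deg) := by
      simp only [sgn_mul]
      apply sgn_eq
      push_cast
      generalize (a'.deg : ZMod 2) = x1, (a''.deg : ZMod 2) = x2, (b'.deg : ZMod 2) = y1,
        (b''.deg : ZMod 2) = y2, (c'.deg : ZMod 2) = z1
      revert x1 x2 y1 y2 z1; decide
    linear_combination c * d * e * h
  · have h : sgn (b''.deg * c'.deg) * sgn (a'.deg + (1 + a''.deg) * (b'.deg + c'.deg)) *
        sgn (b''.deg * (a''.deg + 1)) = sgn ((b'.deg + b''.deg) * (a'.deg + a''.deg + 1)) *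
        sgn (a'.deg + (1 + a''.deg) * c'.deg) * sgn (b''.deg * (a'.deg + c'.deg)) *
        sgn (a'.deg * b'.deg) := by
      simp only [sgn_mul]
      apply sgn_eq
      push_cast
      generalize (a'.deg : ZMod 2) = x1, (a''.deg : ZMod 2) = x2, (b'.deg : ZMod 2) = y1,
        (b''.deg : ZMod 2) = y2, (c'.deg : ZMod 2) = z1
      revert x1 x2 y1 y2 z1; decide
    linear_combination c * d * e * h

theorem coA_context (f : Term I → Term I) (Φ : Alg I ⊗[ℚ] Alg I →ₗ[ℚ] Alg I ⊗[ℚ] Alg I)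
    (h : ∀ x, coA (f x) = Φ (coA x)) (r : Term I →₀ ℚ)
    (hr : Finsupp.linearCombination ℚ (coA (I := I)) r = 0) :
    Finsupp.linearCombination ℚ (coA (I := I)) (r.mapDomain f) = 0 := by
  rw [Finsupp.linearCombination_mapDomain]
  have : (coA ∘ f : Term I → _) = Φ ∘ coA := funext h
  rw [this, ← Finsupp.apply_linearCombination, hr, map_zero]

theorem coA_rel {r : Term I →₀ ℚ} (h : Rel r) :
    Finsupp.linearCombination ℚ (coA (I := I)) r = 0 := by
  induction h with
  | symm a b => simp [coA_symm a b]
  | antisymm a b => simp [coA_antisymm a b, ← add_smul]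
  | assoc a b c => simp [coA_assoc a b c]
  | leibniz a b c => simp [coA_leibniz a b c]
  | E_left r t _ ih =>
    refine coA_context _ (lsum (expand t) fun q => q.1 • TensorProduct.map (ElA q.2.1)
      (ElA q.2.2 ∘ₗ signA q.2.1.deg)) (fun x => ?_) r ih
    rw [coA_eq, lsum_expand_E, lsum_comm, lsum_apply]
    refine lsum_congr fun q _ => ?_
    rw [LinearMap.smul_apply, coA_eq, map_lsum, smul_lsum]
    refine lsum_congr fun p _ => ?_
    simp only [vA, sE, ElA, signA, map_smul, TensorProduct.map_tmul, LinearMap.comp_apply,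
      descend_cA, TensorProduct.tmul_smul, smul_smul]
    congr 1
    rw [mul_comm p.2.2.deg]; ring
  | E_right t r _ ih =>
    refine coA_context _ (lsum (expand t) fun p => p.1 • TensorProduct.map
      (ErA p.2.1 ∘ₗ signA p.2.2.deg) (ErA p.2.2)) (fun x => ?_) r ih
    rw [coA_eq, lsum_expand_E, lsum_apply]
    refine lsum_congr fun p _ => ?_
    rw [LinearMap.smul_apply, coA_eq, map_lsum, smul_lsum]
    refine lsum_congr fun q _ => ?_
    simp only [vA, sE, ErA, signA, map_smul, TensorProduct.map_tmul, LinearMap.comp_apply,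
      descend_cA, ← TensorProduct.smul_tmul', smul_smul]
    congr 1
    ring
  | Ω_left r t _ ih =>
    refine coA_context _ (lsum (expand t) fun q => q.1 • (TensorProduct.map (ΩlA q.2.1)
      (ElA q.2.2 ∘ₗ signA q.2.1.deg) + sgn q.2.1.deg • TensorProduct.map (ElA q.2.1 ∘ₗ signA 1)
      (ΩlA q.2.2 ∘ₗ signA q.2.1.deg))) (fun x => ?_) r ih
    rw [coA_eq, lsum_expand_Ω, lsum_comm, lsum_apply]
    refine lsum_congr fun q _ => ?_
    rw [LinearMap.smul_apply, coA_eq, map_lsum, smul_lsum]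
    refine lsum_congr fun p _ => ?_
    simp only [vA, sΩ₁, sΩ₂, ElA, ΩlA, signA, map_smul, TensorProduct.map_tmul,
      LinearMap.comp_apply, LinearMap.add_apply, LinearMap.smul_apply,
      descend_cA, TensorProduct.tmul_smul, ← TensorProduct.smul_tmul', smul_smul, smul_add]
    congr 2
    · rw [mul_comm p.2.2.deg]; ring
    · rw [add_mul, ← sgn_mul, ← sgn_mul, mul_comm p.2.2.deg]; ring
  | Ω_right t r _ ih =>
    refine coA_context _ (lsum (expand t) fun p => p.1 • (TensorProduct.map
      (ΩrA p.2.1 ∘ₗ signA p.2.2.deg) (ErA p.2.2) + sgn p.2.1.deg • TensorProduct.map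
      (ErA p.2.1 ∘ₗ signA (1 + p.2.2.deg)) (ΩrA p.2.2))) (fun x => ?_) r ih
    rw [coA_eq, lsum_expand_Ω, lsum_apply]
    refine lsum_congr fun p _ => ?_
    rw [LinearMap.smul_apply, coA_eq, map_lsum, smul_lsum]
    refine lsum_congr fun q _ => ?_
    simp only [vA, sΩ₁, sΩ₂, ErA, ΩrA, signA, map_smul, TensorProduct.map_tmul,
      LinearMap.comp_apply, LinearMap.add_apply, LinearMap.smul_apply,
      descend_cA, TensorProduct.tmul_smul, ← TensorProduct.smul_tmul', smul_smul, smul_add]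
    congr 2
    · ring
    · rw [← sgn_mul, add_mul, one_mul]; ring_nf

section Descent

variable [Fintype I]

theorem linearCombination_mk (s : LinTerm I →₀ ℚ) :
    Finsupp.linearCombination ℚ (mk (I := I)) s = (relations I).mkQ s := by
  have : Finsupp.linearCombination ℚ (mk (I := I)) = (relations I).mkQ := by
    ext t; simp [mk]
  rw [this]

theorem span_mk : Submodule.span ℚ (Set.range (mk (I := I))) = ⊤ := by
  rw [← Finsupp.range_linearCombination, LinearMap.range_eq_top]
  intro x
  obtain ⟨s, rfl⟩ := (relations I).mkQ_surjective x
  exact ⟨s, linearCombination_mk s⟩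

/-- A function on multilinear terms, extended linearly, descends to `Bess(I)` if it respects the
relations. -/
def Bess.lift {M : Type*} [AddCommGroup M] [Module ℚ M] (F : LinTerm I → M)
    (hF : ∀ r : LinTerm I →₀ ℚ, Rel (r.mapDomain Subtype.val) →
      Finsupp.linearCombination ℚ F r = 0) : Bess I →ₗ[ℚ] M :=
  (relations I).liftQ (Finsupp.linearCombination ℚ F) (Submodule.span_le.2 fun r hr => hF r hr)

@[simp] theorem Bess.lift_mk {M : Type*} [AddCommGroup M] [Module ℚ M] (F : LinTerm I → M)
    (hF : ∀ r : LinTerm I →₀ ℚ, Rel (r.mapDomain Subtype.val) →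
      Finsupp.linearCombination ℚ F r = 0) (t : LinTerm I) : Bess.lift F hF (mk t) = F t := by
  have := LinearMap.congr_fun ((relations I).liftQ_mkQ (Finsupp.linearCombination ℚ F)
    (Submodule.span_le.2 fun r hr => hF r hr)) (.single t 1)
  rw [LinearMap.comp_apply, Finsupp.linearCombination_single, one_smul] at this
  exact this

variable [DecidableEq I]

theorem cls_rel {r : Term I →₀ ℚ} (h : Rel r) :
    Finsupp.linearCombination ℚ (cls (I := I)) r = 0 := by
  obtain ⟨m, d, H⟩ := h.homogeneous
  by_cases hm : m = Finset.univ.val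
  · have hs : (r.support : Set (Term I)) ⊆ Set.range (Subtype.val : LinTerm I → Term I) :=
      fun t ht => ⟨⟨t, (H t ht).1.trans hm⟩, rfl⟩
    obtain ⟨s, rfl⟩ : ∃ s : LinTerm I →₀ ℚ, s.mapDomain Subtype.val = r :=
      ⟨_, Finsupp.mapDomain_comapDomain _ Subtype.val_injective r hs⟩
    rw [Finsupp.linearCombination_mapDomain]
    have : (cls ∘ Subtype.val : LinTerm I → Bess I) = mk := by
      funext t; simp only [Function.comp, cls, dif_pos t.2]
    rw [this, linearCombination_mk]
    exact (Submodule.Quotient.mk_eq_zero _).2 (Submodule.subset_span h)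
  · rw [Finsupp.linearCombination_apply]
    refine Finset.sum_eq_zero fun t ht => ?_
    have : cls t = (0 : Bess I) := dif_neg fun h => hm ((H t ht).1.symm.trans h)
    simp only [this, smul_zero]

variable (I) in
/-- The coproduct of `Bess(I)`. -/
def coproduct : Bess I →ₗ[ℚ] Bess I ⊗[ℚ] Bess I :=
  Bess.lift (fun t => evalExp cls (expand t.1)) fun r hr => by
    let P : Alg I →ₗ[ℚ] Bess I := descend cls fun r hr => cls_rel hr
    have h : (fun t : LinTerm I => evalExp cls (expand t.1)) =
        TensorProduct.map P P ∘ coA ∘ Subtype.val := by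
      funext t
      change lsum _ _ = TensorProduct.map P P (lsum _ _)
      rw [map_lsum]
      refine lsum_congr fun p _ => ?_
      simp [P]
    rw [h, ← Finsupp.apply_linearCombination, ← Finsupp.linearCombination_mapDomain, coA_rel hr,
      map_zero]

theorem coproduct_mk (t : LinTerm I) : coproduct I (mk t) = evalExp cls (expand t.1) :=
  Bess.lift_mk _ _ t

end Descent

end Coproduct

section Dual

variable (I : Type*) [Fintype I]

/-- The dual space `Bess*(I)`. -/
abbrev BessDual : Type _ := Module.Dual ℚ (Bess I)

variable {I} [DecidableEq I]

/-- The product of `Bess*(I)`: if `Δ x = ∑ x' ⊗ x''` then `(f * g) x = ∑ f x' * g x''`, without a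
Koszul sign, which is the opposite of the graded dual product. -/
instance : Mul (BessDual I) :=
  ⟨fun f g => LinearMap.mul' ℚ ℚ ∘ₗ TensorProduct.map f g ∘ₗ coproduct I⟩

end Dual

section Y

variable {I : Type*}

/-- `1` for terms of degree `0`, and `0` for the others. -/
def eps (t : Term I) : ℚ := if t.deg = 0 then 1 else 0

theorem eps_E (a b : Term I) : eps (E a b) = eps a * eps b := by
  simp only [eps, deg, Nat.add_eq_zero_iff]
  split_ifs <;> simp_all

theorem eps_Ω (a b : Term I) : eps (Ω a b) = 0 := by simp [eps, deg]

theorem eps_mul_sgn (a : Term I) (n : ℕ) : eps a * sgn (a.deg * n) = eps a := by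
  by_cases h : a.deg = 0 <;> simp [eps, h, sgn]

theorem linearCombination_of_eq {F G H : Term I → ℚ} {r : Term I →₀ ℚ} (α β : ℚ)
    (h : ∀ x ∈ r.support, F x = α * G x + β * H x) (hG : Finsupp.linearCombination ℚ G r = 0)
    (hH : Finsupp.linearCombination ℚ H r = 0) : Finsupp.linearCombination ℚ F r = 0 := by
  have : Finsupp.linearCombination ℚ F r =
      α * Finsupp.linearCombination ℚ G r + β * Finsupp.linearCombination ℚ H r := by
    simp only [Finsupp.linearCombination_apply, Finsupp.sum, Finset.mul_sum,
      ← Finset.sum_add_distrib, smul_eq_mul]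
    refine Finset.sum_congr rfl fun x hx => ?_
    rw [h x hx]; ring
  rw [this, hG, hH]; simp

theorem eps_rel {r : Term I →₀ ℚ} (h : Rel r) : Finsupp.linearCombination ℚ (eps (I := I)) r = 0 := by
  induction h with
  | symm a b =>
    simp only [map_sub, Finsupp.linearCombination_single, smul_eq_mul, eps_E]
    linear_combination -eps b * eps_mul_sgn a b.deg
  | antisymm a b => simp [eps_Ω]
  | assoc a b c => simp [eps_E, mul_assoc]
  | leibniz a b c => simp [eps_E, eps_Ω]
  | E_left r t _ ih =>
    rw [Finsupp.linearCombination_mapDomain]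
    exact linearCombination_of_eq (eps t) 0 (fun x _ => by simp [eps_E, mul_comm]) ih ih
  | E_right t r _ ih =>
    rw [Finsupp.linearCombination_mapDomain]
    exact linearCombination_of_eq (eps t) 0 (fun x _ => by simp [eps_E]) ih ih
  | Ω_left r t _ ih =>
    rw [Finsupp.linearCombination_mapDomain]
    exact linearCombination_of_eq 0 0 (fun x _ => by simp [eps_Ω]) ih ih
  | Ω_right t r _ ih =>
    rw [Finsupp.linearCombination_mapDomain]
    exact linearCombination_of_eq 0 0 (fun x _ => by simp [eps_Ω]) ih ih

variable [DecidableEq I]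

/-- The number of leaves labelled `i`. -/
def cnt (i : I) (t : Term I) : ℚ := t.leaves.count i

theorem cnt_E (i : I) (a b : Term I) : cnt i (E a b) = cnt i a + cnt i b := by simp [cnt, leaves]

/-- The coefficient, in a term, of the oriented forest with the tree `Ω_{i,j}` and trivial trees:
it vanishes unless the term has exactly one node `Ω`, and if this node is `Ω a b`, then it is `1`
if `i` is in `a` and `j` is in `b`, it is `-1` if `j` is in `a` and `i` is in `b`, and it is `0`
otherwise. -/
def coeffY (i j : I) : Term I → ℚ
  | leaf _ => 0
  | E a b => coeffY i j a * eps b + eps a * coeffY i j b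
  | Ω a b => eps a * eps b * (cnt i a * cnt j b - cnt j a * cnt i b)

theorem coeffY_rel (i j : I) {r : Term I →₀ ℚ} (h : Rel r) :
    Finsupp.linearCombination ℚ (coeffY i j) r = 0 := by
  induction h with
  | symm a b =>
    simp only [map_sub, Finsupp.linearCombination_single, smul_eq_mul, coeffY]
    have h1 := eps_mul_sgn a b.deg
    have h2 := eps_mul_sgn b a.deg
    rw [mul_comm b.deg] at h2
    linear_combination -coeffY i j b * h1 - coeffY i j a * h2
  | antisymm a b =>
    simp only [map_add, Finsupp.linearCombination_single, smul_eq_mul, coeffY]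
    linear_combination eps b * (cnt i b * cnt j a - cnt j b * cnt i a) * eps_mul_sgn a b.deg
  | assoc a b c =>
    simp only [map_sub, Finsupp.linearCombination_single, smul_eq_mul, coeffY, eps_E]; ring
  | leibniz a b c =>
    simp only [map_sub, Finsupp.linearCombination_single, smul_eq_mul, coeffY, eps_E, eps_Ω, cnt_E]
    linear_combination -eps a * eps c * (cnt i a * cnt j c - cnt j a * cnt i c) *
      eps_mul_sgn b (a.deg + 1)
  | E_left r t h ih =>
    rw [Finsupp.linearCombination_mapDomain]
    exact linearCombination_of_eq (eps t) (coeffY i j t)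
      (fun x _ => by simp only [Function.comp, coeffY]; ring) ih (eps_rel h)
  | E_right t r h ih =>
    rw [Finsupp.linearCombination_mapDomain]
    exact linearCombination_of_eq (eps t) (coeffY i j t)
      (fun x _ => by simp only [Function.comp, coeffY]; ring) ih (eps_rel h)
  | Ω_left r t h _ =>
    obtain ⟨m, d, H⟩ := h.homogeneous
    rw [Finsupp.linearCombination_mapDomain]
    refine linearCombination_of_eq
      (eps t * ((m.count i : ℚ) * cnt j t - (m.count j : ℚ) * cnt i t)) 0
      (fun x hx => ?_) (eps_rel h) (eps_rel h)
    simp only [Function.comp, coeffY, cnt, (H x hx).1]; ring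
  | Ω_right t r h _ =>
    obtain ⟨m, d, H⟩ := h.homogeneous
    rw [Finsupp.linearCombination_mapDomain]
    refine linearCombination_of_eq
      (eps t * (cnt i t * (m.count j : ℚ) - cnt j t * (m.count i : ℚ))) 0
      (fun x hx => ?_) (eps_rel h) (eps_rel h)
    simp only [Function.comp, coeffY, cnt, (H x hx).1]; ring

variable [Fintype I]

/-- The element `Y_{i,j}` of `Bess*(I)`: the element of the dual basis that corresponds to the
forest with exactly one inner vertex, with support `{i, j}` and with the orientation of
`Ω_{i,j}`. -/
def Y (i j : I) : BessDual I :=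
  Bess.lift (fun t => coeffY i j t.1) fun r hr => by
    rw [← coeffY_rel i j hr, Finsupp.linearCombination_mapDomain]; rfl

/-! Forests span `Bess(I)`, and on forests `Y i j` takes the values of a dual basis element. -/

theorem IsTree_eq_leaf {t : Term I} (h : t.IsTree) (hd : t.deg = 0) : ∃ i, t = leaf i := by
  cases t with
  | leaf i => exact ⟨i, rfl⟩
  | E a b => exact h.elim
  | Ω a b => simp [deg] at hd

theorem not_mem_trees {t a b : Term I} (hd : t.deg = 0) : Ω a b ∉ t.trees := by
  induction t with
  | leaf i => simp [trees]
  | E c d ihc ihd =>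
    simp only [deg, Nat.add_eq_zero_iff] at hd
    simp [trees, ihc hd.1, ihd hd.2]
  | Ω c d => simp [deg] at hd

theorem coeffY_of_deg {i j : I} {t : Term I} (hd : t.deg ≠ 1) : coeffY i j t = 0 := by
  induction t with
  | leaf i => rfl
  | E a b iha ihb =>
    simp only [coeffY, eps]
    simp only [deg] at hd
    split_ifs with h1 h2 h2
    · rw [iha (by omega), ihb (by omega)]; simp
    · rw [iha (by omega)]; simp
    · rw [ihb (by omega)]; simp
    · simp
  | Ω a b =>
    simp only [coeffY, eps]
    simp only [deg] at hd
    split_ifs <;> first | omega | simp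

open Classical in
theorem coeffY_forest {i j : I} (hij : i ≠ j) {t : Term I} (ht : t.IsForest) (hd : t.deg = 1) :
    coeffY i j t = if Ω (leaf i) (leaf j) ∈ t.trees then 1 else
      if Ω (leaf j) (leaf i) ∈ t.trees then -1 else 0 := by
  induction t with
  | leaf i => simp [deg] at hd
  | E a b iha ihb =>
    simp only [deg] at hd
    simp only [coeffY, trees, Multiset.mem_add]
    rcases (by omega : a.deg = 1 ∧ b.deg = 0 ∨ a.deg = 0 ∧ b.deg = 1) with ⟨ha, hb⟩ | ⟨ha, hb⟩
    · simp [eps, ha, hb, not_mem_trees hb, iha ht.1 ha]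
    · simp [eps, ha, hb, not_mem_trees ha, ihb ht.2 hb]
  | Ω a b =>
    simp only [deg] at hd
    obtain ⟨k, rfl⟩ := IsTree_eq_leaf ht.1 (by omega)
    obtain ⟨l, rfl⟩ := IsTree_eq_leaf ht.2 (by omega)
    simp only [coeffY, eps, deg, cnt, leaves, trees, Multiset.mem_singleton, Term.Ω.injEq,
      Term.leaf.injEq, Multiset.count_singleton]
    split_ifs <;> grind

open Classical in
/-- The values of `Y i j` at the oriented forests on `I`. -/
theorem Y_forest {i j : I} (hij : i ≠ j) (t : LinTerm I) (ht : t.1.IsForest) :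
    Y i j (mk t) =
      if t.1.deg = 1 ∧ Ω (leaf i) (leaf j) ∈ t.1.trees then 1
      else if t.1.deg = 1 ∧ Ω (leaf j) (leaf i) ∈ t.1.trees then -1
      else 0 := by
  classical
  rw [Y, Bess.lift_mk]
  by_cases hd : t.1.deg = 1
  · rw [coeffY_forest hij ht hd]; simp [hd]
  · rw [coeffY_of_deg hd]; simp [hd]

/-- The span in `Alg I` of the forests with given leaves. -/
def forestSpan (m : Multiset I) : Submodule ℚ (Alg I) :=
  Submodule.span ℚ {x | ∃ t : Term I, t.IsForest ∧ t.leaves = m ∧ cA t = x}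

theorem cA_mem_forestSpan {t : Term I} (h : t.IsForest) : cA t ∈ forestSpan t.leaves :=
  Submodule.subset_span ⟨t, h, rfl, rfl⟩

/-- A linear map given on terms by a context maps spans of forests to spans of forests. -/
theorem map_forestSpan (φ : Alg I →ₗ[ℚ] Alg I) (m n : Multiset I)
    (h : ∀ t : Term I, t.IsForest → t.leaves = m → φ (cA t) ∈ forestSpan n) {x : Alg I}
    (hx : x ∈ forestSpan m) : φ x ∈ forestSpan n := by
  have : forestSpan m ≤ (forestSpan n).comap φ := by
    refine Submodule.span_le.2 ?_
    rintro _ ⟨t, ht, hl, rfl⟩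
    exact h t ht hl
  exact this hx

theorem E_forestSpan {a b : Term I} (ha : cA a ∈ forestSpan a.leaves)
    (hb : cA b ∈ forestSpan b.leaves) : cA (E a b) ∈ forestSpan (a.leaves + b.leaves) := by
  have h1 : ElA b (cA a) = cA (E a b) := by simp [ElA]
  rw [← h1]
  refine map_forestSpan _ _ _ (fun s hs hl => ?_) ha
  have h2 : ElA b (cA s) = ErA s (cA b) := by simp [ElA, ErA]
  rw [h2]
  refine map_forestSpan _ _ _ (fun u hu hl' => ?_) hb
  simp only [ErA, descend_cA]
  rw [← hl, ← hl']
  exact cA_mem_forestSpan (t := E s u) ⟨hs, hu⟩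

theorem Ω_forest {a b : Term I} (ha : a.IsForest) (hb : b.IsForest) :
    cA (Ω a b) ∈ forestSpan (a.leaves + b.leaves) := by
  have tree (a : Term I) (ha : a.IsTree) (b : Term I) (hb : b.IsForest) :
      cA (Ω a b) ∈ forestSpan (a.leaves + b.leaves) := by
    induction b with
    | leaf i => exact cA_mem_forestSpan (t := Ω a (leaf i)) ⟨ha, hb⟩
    | Ω b c => exact cA_mem_forestSpan (t := Ω a (Ω b c)) ⟨ha, hb⟩
    | E b c ihb ihc =>
      rw [cA_leibniz]
      refine Submodule.add_mem _ ?_ (Submodule.smul_mem _ _ ?_)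
      · have := E_forestSpan (a := Ω a b) (b := c) (ihb hb.1) (cA_mem_forestSpan hb.2)
        simpa only [leaves, add_assoc] using this
      · have := E_forestSpan (a := b) (b := Ω a c) (cA_mem_forestSpan hb.1) (ihc hb.2)
        simpa only [leaves, add_left_comm] using this
  induction b with
  | leaf i =>
    rw [cA_antisymm, add_comm]
    exact Submodule.neg_mem _ (Submodule.smul_mem _ _ (tree (leaf i) trivial a ha))
  | Ω b c =>
    rw [cA_antisymm, add_comm]
    exact Submodule.neg_mem _ (Submodule.smul_mem _ _ (tree (Ω b c) hb a ha))
  | E b c ihb ihc =>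
    rw [cA_leibniz]
    refine Submodule.add_mem _ ?_ (Submodule.smul_mem _ _ ?_)
    · have := E_forestSpan (a := Ω a b) (b := c) (ihb hb.1) (cA_mem_forestSpan hb.2)
      simpa only [leaves, add_assoc] using this
    · have := E_forestSpan (a := b) (b := Ω a c) (cA_mem_forestSpan hb.1) (ihc hb.2)
      simpa only [leaves, add_left_comm] using this

theorem mem_forestSpan (t : Term I) : cA t ∈ forestSpan t.leaves := by
  induction t with
  | leaf i => exact cA_mem_forestSpan (t := leaf i) trivial
  | E a b iha ihb => exact E_forestSpan iha ihb
  | Ω a b iha ihb =>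
    have h1 : ΩlA b (cA a) = cA (Ω a b) := by simp [ΩlA]
    rw [← h1]
    refine map_forestSpan _ _ _ (fun s hs hl => ?_) iha
    have h2 : ΩlA b (cA s) = ΩrA s (cA b) := by simp [ΩlA, ΩrA]
    rw [h2]
    refine map_forestSpan _ _ _ (fun u hu hl' => ?_) ihb
    simp only [ΩrA, descend_cA]
    simp only [leaves]
    rw [← hl, ← hl']
    exact Ω_forest hs hu

/-- `Bess(I)` is spanned by oriented forests, so `Y_forest` determines `Y i j`. -/
theorem span_forests :
    Submodule.span ℚ {x | ∃ t : LinTerm I, t.1.IsForest ∧ mk t = x} = ⊤ := by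
  rw [eq_top_iff, ← span_mk, Submodule.span_le]
  rintro _ ⟨t, rfl⟩
  let P : Alg I →ₗ[ℚ] Bess I := descend cls fun r hr => cls_rel hr
  have hP (s : LinTerm I) : P (cA s.1) = mk s := by
    simp only [P, descend_cA, cls, dif_pos s.2]
  have h : forestSpan t.1.leaves ≤
      (Submodule.span ℚ {x | ∃ t : LinTerm I, t.1.IsForest ∧ mk t = x}).comap P := by
    refine Submodule.span_le.2 ?_
    rintro _ ⟨s, hs, hl, rfl⟩
    exact Submodule.subset_span ⟨⟨s, hl.trans t.2⟩, hs, (hP _).symm⟩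
  rw [← hP]
  exact h (mem_forestSpan t.1)

end Y


end

end Bessel

/-!
A coefficient of `Y_{i,j} × Y_{k,l} × ⋯` at a forest is nonzero only if the pairs `{i,j}`, `{k,l}`,
… have pairwise distinct lowest common ancestors, because the coproduct keeps each inner vertex in
exactly one of the two factors. Regard the pairs as the edges of a graph on the leaves. Such a graph
has no cycle: the lowest common ancestor of the vertices of a cycle separates them into two parts,
between which the cycle must pass at least twice, although only one edge has that ancestor. All of
this is insensitive to signs and to the parentheses in the product.
-/

namespace Bessel

open Term

section Circulation

variable {α V : Type*}

/-- A finite directed multigraph, given by its multiset of edges, is a circulation if each vertex is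
the source of as many edges as it is the target of. Sums of directed cycles are circulations. -/
def IsCirculation (S : Multiset (V × V)) : Prop := S.map Prod.fst = S.map Prod.snd

theorem isCirculation_triangle (i j k : V) : IsCirculation ({(i, j)} + {(j, k)} + {(k, i)}) := by
  simp only [IsCirculation, Multiset.map_add, Multiset.map_singleton]
  abel

theorem filter_map_add_of_disjoint {f : α → V} {S T : Multiset α} {m n : Multiset V}
    [DecidablePred (· ∈ m)] (hmn : Disjoint m n) (hS : ∀ e ∈ S, f e ∈ m) (hT : ∀ e ∈ T, f e ∈ n) :
    ((S + T).map f).filter (· ∈ m) = S.map f := by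
  have hS' : (S.map f).filter (· ∈ m) = S.map f :=
    Multiset.filter_eq_self.2 (Multiset.forall_mem_map_iff.2 hS)
  have hT' : (T.map f).filter (· ∈ m) = 0 :=
    Multiset.filter_eq_nil.2 (Multiset.forall_mem_map_iff.2 fun e he hm =>
      Multiset.disjoint_left.1 hmn hm (hT e he))
  rw [Multiset.map_add, Multiset.filter_add, hS', hT', add_zero]

variable {S T : Multiset (V × V)} {m n : Multiset V}

theorem IsCirculation.of_add_of_disjoint (h : IsCirculation (S + T)) (hmn : Disjoint m n)
    (hS : ∀ e ∈ S, e.1 ∈ m ∧ e.2 ∈ m) (hT : ∀ e ∈ T, e.1 ∈ n ∧ e.2 ∈ n) :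
    IsCirculation S ∧ IsCirculation T := by
  classical
  have hS' : IsCirculation S := by
    simpa only [IsCirculation,
      filter_map_add_of_disjoint hmn (fun e he => (hS e he).1) fun e he => (hT e he).1,
      filter_map_add_of_disjoint hmn (fun e he => (hS e he).2) fun e he => (hT e he).2]
      using congrArg (Multiset.filter (· ∈ m)) h
  refine ⟨hS', ?_⟩
  rw [IsCirculation, Multiset.map_add, Multiset.map_add, hS'] at h
  exact add_left_cancel h

theorem not_isCirculation_cons_add_of_disjoint {i j : V} (hmn : Disjoint m n)
    (hS : ∀ e ∈ S, e.1 ∈ m ∧ e.2 ∈ m) (hT : ∀ e ∈ T, e.1 ∈ n ∧ e.2 ∈ n)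
    (hij : i ∈ m ∧ j ∈ n ∨ j ∈ m ∧ i ∈ n) : ¬IsCirculation ((i, j) ::ₘ (S + T)) := by
  classical
  intro h
  have hcard := congrArg (fun u => (Multiset.filter (· ∈ m) u).card) h
  simp only [Multiset.map_cons, Multiset.filter_cons, Multiset.card_add,
    filter_map_add_of_disjoint hmn (fun e he => (hS e he).1) fun e he => (hT e he).1,
    filter_map_add_of_disjoint hmn (fun e he => (hS e he).2) fun e he => (hT e he).2,
    Multiset.card_map, add_left_inj] at hcard
  rcases hij with ⟨hi, hj⟩ | ⟨hj, hi⟩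
  · have hjm : j ∉ m := fun hm => Multiset.disjoint_left.1 hmn hm hj
    simp [hi, hjm] at hcard
  · have him : i ∉ m := fun hm => Multiset.disjoint_left.1 hmn hm hi
    simp [hj, him] at hcard

end Circulation

section Joins

variable {I : Type*}

/-- `t.Joins S` says that the pairs of leaves in `S` can be assigned to pairwise distinct nodes `Ω`
of `t`, each pair having its two members on the two sides of its node. If no label is repeated in
`t`, that node is the lowest common ancestor of the pair. -/
inductive Term.Joins : Term I → Multiset (I × I) → Prop
  | leaf (i : I) : Joins (leaf i) 0
  | E {a b : Term I} {S T : Multiset (I × I)} : Joins a S → Joins b T → Joins (E a b) (S + T)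
  | Ω {a b : Term I} {S T : Multiset (I × I)} : Joins a S → Joins b T → Joins (Ω a b) (S + T)
  | Ω_cons {a b : Term I} {S T : Multiset (I × I)} {i j : I} :
      i ∈ a.leaves ∧ j ∈ b.leaves ∨ j ∈ a.leaves ∧ i ∈ b.leaves →
      Joins a S → Joins b T → Joins (Ω a b) ((i, j) ::ₘ (S + T))

theorem Term.joins_zero (t : Term I) : t.Joins 0 := by
  induction t with
  | leaf i => exact .leaf i
  | E a b iha ihb => exact .E iha ihb
  | Ω a b iha ihb => exact .Ω iha ihb

theorem Term.Joins.mem_leaves {t : Term I} {S : Multiset (I × I)} (h : t.Joins S) :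
    ∀ e ∈ S, e.1 ∈ t.leaves ∧ e.2 ∈ t.leaves := by
  induction h with
  | leaf i => simp
  | E _ _ iha ihb | Ω _ _ iha ihb =>
    simp only [leaves, Multiset.mem_add]
    rintro e (he | he)
    · exact (iha e he).imp .inl .inl
    · exact (ihb e he).imp .inr .inr
  | Ω_cons hij _ _ iha ihb =>
    simp only [leaves, Multiset.mem_add, Multiset.mem_cons]
    rintro e (rfl | he | he)
    · exact hij.elim (.imp .inl .inr) fun h => ⟨.inr h.2, .inl h.1⟩
    · exact (iha e he).imp .inl .inl
    · exact (ihb e he).imp .inr .inr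

theorem Term.Joins.eq_zero_of_isCirculation {t : Term I} {S : Multiset (I × I)} (h : t.Joins S)
    (ht : t.leaves.Nodup) (hS : IsCirculation S) : S = 0 := by
  induction h with
  | leaf i => rfl
  | E ha hb iha ihb | Ω ha hb iha ihb =>
    obtain ⟨hna, hnb, hab⟩ := Multiset.nodup_add.1 ht
    obtain ⟨hSa, hSb⟩ := hS.of_add_of_disjoint hab ha.mem_leaves hb.mem_leaves
    rw [iha hna hSa, ihb hnb hSb, add_zero]
  | Ω_cons hij ha hb =>
    have hab := (Multiset.nodup_add.1 ht).2.2
    exact (not_isCirculation_cons_add_of_disjoint hab ha.mem_leaves hb.mem_leaves hij hS).elim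

theorem Term.joins_singleton_of_coeffY_ne_zero [DecidableEq I] {i j : I} {t : Term I}
    (h : coeffY i j t ≠ 0) : t.Joins {(i, j)} := by
  induction t with
  | leaf => exact (h rfl).elim
  | E a b iha ihb =>
    have hab : coeffY i j a ≠ 0 ∨ coeffY i j b ≠ 0 := by
      by_contra! hab
      simp [coeffY, hab] at h
    rcases hab with ha | hb
    · exact .E (iha ha) b.joins_zero
    · simpa only [zero_add] using Joins.E a.joins_zero (ihb hb)
  | Ω a b =>
    have hab : cnt i a * cnt j b ≠ 0 ∨ cnt j a * cnt i b ≠ 0 := by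
      by_contra! hab
      simp [coeffY, hab] at h
    simp only [cnt, ne_eq, mul_eq_zero, not_or, Nat.cast_eq_zero, Multiset.count_eq_zero,
      not_not] at hab
    exact .Ω_cons hab a.joins_zero b.joins_zero

end Joins

section Split

variable {I : Type*}

/-- `Split t x y` says that `x` and `y` arise from `t` by keeping each node `Ω` in one of them and
replacing it by `E` in the other one. Up to scalars, the coproduct of `t` is the sum of these
`x ⊗ y`. -/
inductive Split : Term I → Term I → Term I → Prop
  | leaf (i : I) : Split (leaf i) (leaf i) (leaf i)
  | E {a b x x' y y' : Term I} : Split a x y → Split b x' y' → Split (E a b) (E x x') (E y y')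
  | Ω_left {a b x x' y y' : Term I} :
      Split a x y → Split b x' y' → Split (Ω a b) (Ω x x') (E y y')
  | Ω_right {a b x x' y y' : Term I} :
      Split a x y → Split b x' y' → Split (Ω a b) (E x x') (Ω y y')

theorem split_of_mem_expand {t : Term I} {p : ℚ × Term I × Term I} (hp : p ∈ expand t) :
    Split t p.2.1 p.2.2 := by
  induction t generalizing p with
  | leaf i =>
    obtain rfl := List.mem_singleton.1 hp
    exact .leaf i
  | E a b iha ihb =>
    simp only [expand, List.mem_flatMap, List.mem_map] at hp
    obtain ⟨q, hq, r, hr, rfl⟩ := hp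
    exact .E (iha hq) (ihb hr)
  | Ω a b iha ihb =>
    simp only [expand, List.mem_append, List.mem_flatMap, List.mem_map] at hp
    rcases hp with ⟨q, hq, r, hr, rfl⟩ | ⟨q, hq, r, hr, rfl⟩
    · exact .Ω_left (iha hq) (ihb hr)
    · exact .Ω_right (iha hq) (ihb hr)

variable {t x y : Term I}

theorem Split.leaves_left (h : Split t x y) : x.leaves = t.leaves := by
  induction h <;> simp only [leaves, *]

theorem Split.leaves_right (h : Split t x y) : y.leaves = t.leaves := by
  induction h <;> simp only [leaves, *]

theorem Split.joins_add {S T : Multiset (I × I)} (h : Split t x y) (hx : x.Joins S)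
    (hy : y.Joins T) : t.Joins (S + T) := by
  induction h generalizing S T with
  | leaf i =>
    cases hx
    cases hy
    exact .leaf i
  | E _ _ iha ihb =>
    obtain _ | ⟨hx, hx'⟩ := hx
    obtain _ | ⟨hy, hy'⟩ := hy
    rw [add_add_add_comm]
    exact .E (iha hx hy) (ihb hx' hy')
  | Ω_left ha hb iha ihb =>
    obtain _ | ⟨hy, hy'⟩ := hy
    obtain _ | _ | ⟨hx, hx'⟩ | ⟨hij, hx, hx'⟩ := hx
    · rw [add_add_add_comm]
      exact .Ω (iha hx hy) (ihb hx' hy')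
    · rw [Multiset.cons_add, add_add_add_comm]
      rw [ha.leaves_left, hb.leaves_left] at hij
      exact .Ω_cons hij (iha hx hy) (ihb hx' hy')
  | Ω_right ha hb iha ihb =>
    obtain _ | ⟨hx, hx'⟩ := hx
    obtain _ | _ | ⟨hy, hy'⟩ | ⟨hij, hy, hy'⟩ := hy
    · rw [add_add_add_comm]
      exact .Ω (iha hx hy) (ihb hx' hy')
    · rw [Multiset.add_cons, add_add_add_comm]
      rw [ha.leaves_right, hb.leaves_right] at hij
      exact .Ω_cons hij (iha hx hy) (ihb hx' hy')

end Split

section SupportedOn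

variable {I : Type*} [Fintype I]

/-- A functional on `Bess(I)` is supported on a multiset `S` of pairs of leaves if it vanishes at
all terms that do not join the pairs in `S` at distinct nodes. -/
def SupportedOn (f : BessDual I) (S : Multiset (I × I)) : Prop :=
  ∀ t : LinTerm I, ¬t.1.Joins S → f (mk t) = 0

variable {f g : BessDual I} {S T : Multiset (I × I)}

theorem SupportedOn.eq_zero_of_isCirculation (hf : SupportedOn f S) (hS : IsCirculation S)
    (hS₀ : S ≠ 0) : f = 0 := by
  refine LinearMap.ext_on_range span_mk fun t => hf t fun ht => hS₀ ?_
  have nodup : t.1.leaves.Nodup := by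
    rw [t.2]
    exact Finset.univ.nodup
  exact ht.eq_zero_of_isCirculation nodup hS

variable [DecidableEq I]

theorem supportedOn_Y (i j : I) : SupportedOn (Y i j) {(i, j)} := by
  intro t ht
  rw [Y, Bess.lift_mk]
  by_contra h
  exact ht (joins_singleton_of_coeffY_ne_zero h)

theorem SupportedOn.apply_cls_eq_zero (hf : SupportedOn f S) {t : Term I} (ht : ¬t.Joins S) :
    f (cls t) = 0 := by
  unfold cls
  split_ifs with h
  · exact hf ⟨t, h⟩ ht
  · exact map_zero f

theorem mul_apply_mk (f g : BessDual I) (t : LinTerm I) :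
    (f * g) (mk t) =
      ((expand t.1).map fun p => p.1 * (f (cls p.2.1) * g (cls p.2.2))).sum := by
  change LinearMap.mul' ℚ ℚ (TensorProduct.map f g (coproduct I (mk t))) = _
  rw [coproduct_mk, evalExp, map_list_sum, map_list_sum, List.map_map, List.map_map]
  simp [Function.comp_def]

theorem SupportedOn.mul (hf : SupportedOn f S) (hg : SupportedOn g T) :
    SupportedOn (f * g) (S + T) := by
  intro t ht
  rw [mul_apply_mk]
  refine List.sum_eq_zero (List.forall_mem_map.2 fun p hp => ?_)
  by_cases hS : p.2.1.Joins S
  · have hT : ¬p.2.2.Joins T := fun hT => ht ((split_of_mem_expand hp).joins_add hS hT)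
    rw [hg.apply_cls_eq_zero hT, mul_zero, mul_zero]
  · rw [hf.apply_cls_eq_zero hS, zero_mul, mul_zero]

end SupportedOn

end Bessel

theorem mainTheorem9 {I : Type*} [Fintype I] [DecidableEq I] (i j k : I)
    (hij : i ≠ j) (hjk : j ≠ k) (hki : k ≠ i) :
    (Bessel.Y i j * Bessel.Y j k) * Bessel.Y k i = 0 ∧
      Bessel.Y i j * (Bessel.Y j k * Bessel.Y k i) = 0 := by
  have supp_ij := Bessel.supportedOn_Y i j
  have supp_jk := Bessel.supportedOn_Y j k
  have supp_ki := Bessel.supportedOn_Y k i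
  have triangle := Bessel.isCirculation_triangle i j k
  constructor
  · exact ((supp_ij.mul supp_jk).mul supp_ki).eq_zero_of_isCirculation triangle (by simp)
  · rw [add_assoc] at triangle
    exact (supp_ij.mul (supp_jk.mul supp_ki)).eq_zero_of_isCirculation triangle (by simp)
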